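/- A p-algebra is a bounded distributive lattice with a unary operation $*$ such that $x\wedge y=0$ if and only if $x\le y^*$. For $m\ge 0$ let $\bar{\mathbf B}_m$ be the p-algebra obtained from the Boolean algebra with $m$ atoms by adding a new top element above the old one, and let $\mathsf{Pa}_m=\mathbf{HSP}(\bar{\mathbf B}_m)$ be the variety it generates. For a finite poset $P$ let $\varepsilon(P)$ be the p-algebra of upsets of $P$, ordered by inclusion, with $V^*=\{x\in P : \text{no } y\ge x \text{ lies in } V\}$. For a p-algebra $\mathbf A$ let $\mathbf Q(\mathbf A)$ be the quasivariety generated by $\mathbf A$, that is, the class of all p-algebras satisfying every quasi-identity valid in $\mathbf A$. For a non-empty set $M$ and a possibly empty family $\mathcal F$ of non-empty subsets of $M$ let $$P(M,\mathcal F)=\{M\}\cup\{\{x\}: x\in M\}\cup\mathcal F,$$ ordered by reverse inclusion. Theorem. Let $m\ge 2$, let $M$ be a set with $|M|=m+1$, let $\mathcal F$ be a family of non-empty subsets of $M$, and let $P=P(M,\mathcal F)$. Then $\mathsf{Pa}_m\subseteq\mathbf Q(\varepsilon(P))$ if and only if there are distinct $a,b\in M$ such that $$\mathcal F\setminus\bigl(\{M\}\cup\{\{x\}:x\in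 M\}\bigr)\subseteq\bigl\{\{a,b\},\ M\setminus\{a\},\ M\setminus\{b\}\bigr\}.$$ In particular, if $\mathcal F$ contains neither $M$ nor a singleton, then $\mathsf{Pa}_m\subseteq\mathbf Q(\varepsilon(P))$ if and only if $\mathcal F\subseteq\{\{a,b\},M\setminus\{a\},M\setminus\{b\}\}$ for some distinct $a,b\in M$. -/

import Mathlib

universe u v w

/-- A p-algebra: a bounded distributive lattice with a unary operation `pc` (written `*` in the
literature) such that `x ⊓ y = ⊥` if and only if `x ≤ pc y`. -/
class PAlgebra (α : Type u) extends DistribLattice α, BoundedOrder α where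
  pc : α → α
  inf_eq_bot_iff : ∀ x y : α, x ⊓ y = ⊥ ↔ x ≤ pc y

/-- Bundled p-algebras with carrier in `Type u`. A class of p-algebras is a `Set PAlg`. -/
structure PAlg : Type (u + 1) where
  carrier : Type u
  [str : PAlgebra carrier]

attribute [instance] PAlg.str

/-- Homomorphisms of p-algebras, in the signature `⊓, ⊔, pc, ⊥, ⊤`. -/
structure PHom (α : Type u) (β : Type v) [PAlgebra α] [PAlgebra β] where
  toFun : α → β
  map_inf : ∀ x y, toFun (x ⊓ y) = toFun x ⊓ toFun y
  map_sup : ∀ x y, toFun (x ⊔ y) = toFun x ⊔ toFun y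
  map_pc : ∀ x, toFun (PAlgebra.pc x) = PAlgebra.pc (toFun x)
  map_bot : toFun ⊥ = ⊥
  map_top : toFun ⊤ = ⊤

/-- The direct power of a p-algebra, with coordinatewise operations. -/
instance PAlgebra.power (ι : Type v) (α : Type u) [PAlgebra α] : PAlgebra (ι → α) where
  pc f := fun i => PAlgebra.pc (f i)
  inf_eq_bot_iff f g := by
    rw [funext_iff, Pi.le_def]
    exact forall_congr' fun i => PAlgebra.inf_eq_bot_iff (f i) (g i)

/-- The variety `HSP(A)` generated by `A`: all homomorphic images of algebras `C` that are
isomorphic to a subalgebra of a direct power of `A`. -/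
def HSP (A : PAlg.{0}) : Set PAlg.{w} :=
  {B | ∃ (ι : Type w) (C : PAlg.{w}) (e : PHom C.carrier (ι → A.carrier))
      (h : PHom C.carrier B.carrier),
      Function.Injective e.toFun ∧ Function.Surjective h.toFun}

/-- Terms in the language of p-algebras over countably many variables. -/
inductive PTerm : Type
  | var : ℕ → PTerm
  | inf : PTerm → PTerm → PTerm
  | sup : PTerm → PTerm → PTerm
  | pc : PTerm → PTerm
  | bot : PTerm
  | top : PTerm

/-- The value of a term under an assignment of its variables. -/
def PTerm.eval {α : Type u} [PAlgebra α] (ρ : ℕ → α) : PTerm → α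
  | .var n => ρ n
  | .inf s t => s.eval ρ ⊓ t.eval ρ
  | .sup s t => s.eval ρ ⊔ t.eval ρ
  | .pc t => PAlgebra.pc (t.eval ρ)
  | .bot => ⊥
  | .top => ⊤

/-- A quasi-identity `s₁ ≈ t₁ ∧ … ∧ sₙ ≈ tₙ → s ≈ t` (with `n = 0` allowed). -/
structure QuasiIdentity : Type where
  premises : List (PTerm × PTerm)
  conclusion : PTerm × PTerm

/-- The quasi-identity `q` is valid in `A`. -/
def PAlg.Models (A : PAlg.{u}) (q : QuasiIdentity) : Prop :=
  ∀ ρ : ℕ → A.carrier,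
    (∀ e ∈ q.premises, e.1.eval ρ = e.2.eval ρ) →
      q.conclusion.1.eval ρ = q.conclusion.2.eval ρ

/-- A quasivariety of p-algebras: a class axiomatized by quasi-identities. -/
def IsQuasivariety (K : Set PAlg.{u}) : Prop :=
  ∃ Q : Set QuasiIdentity, K = {B | ∀ q ∈ Q, B.Models q}

/-- The quasivariety `Q(A)` generated by `A`: all p-algebras that satisfy every quasi-identity
valid in `A`. -/
def quasivarietyGen (A : PAlg.{u}) : Set PAlg.{w} :=
  {B | ∀ q : QuasiIdentity, A.Models q → B.Models q}

/-- `Q(A)` is the smallest quasivariety that contains `A`. -/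
theorem quasivarietyGen_isLeast (A : PAlg.{u}) :
    IsLeast {K : Set PAlg.{u} | IsQuasivariety K ∧ A ∈ K} (quasivarietyGen A) := by
  refine ⟨⟨⟨{q | A.Models q}, rfl⟩, fun q hq => hq⟩, ?_⟩
  rintro K ⟨⟨Q, rfl⟩, hA⟩ B hB q hq
  exact hB q (hA q hq)

open Classical in
/-- The algebra `B̄ₘ`: the Boolean algebra of all subsets of an `m`-element set together with an
extra element on top, covering the old top element. -/
noncomputable instance barB.instPAlgebra (m : ℕ) : PAlgebra (WithTop (Set (Fin m))) where
  pc x :=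
    match x with
    | ⊤ => ((∅ : Set (Fin m)) : WithTop (Set (Fin m)))
    | (s : Set (Fin m)) => if s = ∅ then ⊤ else ((sᶜ : Set (Fin m)) : WithTop (Set (Fin m)))
  inf_eq_bot_iff x y := by
    have hb : (⊥ : WithTop (Set (Fin m))) = ((∅ : Set (Fin m)) : WithTop (Set (Fin m))) := rfl
    rw [hb]
    induction y using WithTop.recTopCoe with
    | top =>
      rw [inf_top_eq]
      constructor
      · exact fun h => h.le
      · exact fun h => le_antisymm h (by rw [← hb]; exact bot_le)
    | coe s =>
      by_cases hs : s = ∅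
      · subst hs
        have : x ⊓ ((∅ : Set (Fin m)) : WithTop (Set (Fin m))) = (∅ : Set (Fin m)) := by
          rw [← hb]; exact inf_bot_eq x
        simp [this]
      · simp only [hs, if_false]
        induction x using WithTop.recTopCoe with
        | top =>
          rw [top_inf_eq]
          simp [hs]
        | coe t =>
          rw [← WithTop.coe_inf, WithTop.coe_le_coe, WithTop.coe_inj]
          exact Set.subset_compl_iff_disjoint_right.trans Set.disjoint_iff_inter_eq_empty |>.symm

/-- `B̄ₘ` as a bundled p-algebra. -/
noncomputable def barB (m : ℕ) : PAlg.{0} := ⟨WithTop (Set (Fin m))⟩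

/-- The variety `Paₘ = HSP(B̄ₘ)`. -/
def Pa (m : ℕ) : Set PAlg.{w} := HSP (barB m)

/-- The carrier of the dual p-algebra `ε(P)` of a poset `P`: the upsets of `P`. -/
structure Upset (P : Type u) [PartialOrder P] where
  carrier : Set P
  upper : IsUpperSet carrier

/-- Upsets are ordered by inclusion; `⊓, ⊔, ⊥, ⊤` are `∩, ∪, ∅, P`, and the pseudocomplement of
`V` is the set of all points with no point of `V` above them. -/
instance Upset.instPAlgebra (P : Type u) [PartialOrder P] : PAlgebra (Upset P) where
  le U V := U.carrier ⊆ V.carrier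
  le_refl _ := Set.Subset.rfl
  le_trans _ _ _ h k := Set.Subset.trans h k
  le_antisymm := by
    rintro ⟨U, hU⟩ ⟨V, hV⟩ h k
    obtain rfl : U = V := Set.Subset.antisymm h k
    rfl
  inf U V := ⟨U.carrier ∩ V.carrier, U.upper.inter V.upper⟩
  sup U V := ⟨U.carrier ∪ V.carrier, U.upper.union V.upper⟩
  inf_le_left _ _ := Set.inter_subset_left
  inf_le_right _ _ := Set.inter_subset_right
  le_inf _ _ _ h k := Set.subset_inter h k
  le_sup_left _ _ := Set.subset_union_left
  le_sup_right _ _ := Set.subset_union_right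
  sup_le _ _ _ h k := Set.union_subset h k
  le_sup_inf _ _ _ := (Set.union_inter_distrib_left _ _ _).symm.subset
  bot := ⟨∅, isUpperSet_empty⟩
  top := ⟨Set.univ, isUpperSet_univ⟩
  bot_le _ := Set.empty_subset _
  le_top _ := Set.subset_univ _
  pc V := ⟨{x | ∀ y, x ≤ y → y ∉ V.carrier}, fun _ _ hab ha y hy => ha y (hab.trans hy)⟩
  inf_eq_bot_iff U V := by
    constructor
    · intro h x hx y hxy hy
      have h' : U.carrier ∩ V.carrier = ∅ := congrArg Upset.carrier h
      exact (Set.eq_empty_iff_forall_notMem.mp h') y ⟨U.upper hxy hx, hy⟩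
    · intro h
      have h' : U.carrier ∩ V.carrier = ∅ :=
        Set.eq_empty_iff_forall_notMem.mpr fun x hx => h hx.1 x le_rfl hx.2
      change (⟨U.carrier ∩ V.carrier, _⟩ : Upset P) = ⟨∅, _⟩
      simp only [h']

/-- The dual p-algebra `ε(P)` of the poset `P`. -/
def dualAlg (P : Type u) [PartialOrder P] : PAlg.{u} := ⟨Upset P⟩

/-- The trivial members of `P(M, F)`, present for every `F`: the whole base `M` and the
singletons `{a}` with `a ∈ M`. -/
def baseSets (M : Type u) : Set (Set M) := {X | X = Set.univ ∨ ∃ a : M, X = {a}}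

/-- The underlying set of the reduced poset `P(M, F)` with base `M`:
`{M} ∪ {{a} : a ∈ M} ∪ F`. -/
def ReducedPoset (M : Type u) (F : Set (Set M)) : Type u := {X : Set M // X ∈ baseSets M ∪ F}

/-- The order of `P(M, F)` is reverse inclusion. -/
instance ReducedPoset.instPartialOrder (M : Type u) (F : Set (Set M)) :
    PartialOrder (ReducedPoset M F) where
  le A B := B.1 ⊆ A.1
  le_refl _ := Set.Subset.rfl
  le_trans _ _ _ h k := Set.Subset.trans k h
  le_antisymm _ _ h k := Subtype.ext (Set.Subset.antisymm k h)

/-! Both directions turn homomorphisms into `ε(P)` into maps from `P` to prime ideals, where a point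
and its image have the same minimal primes accessible. Sufficiency: let `x ≰ y` in an algebra of `Pa
m`, and let `I` be a prime ideal containing `y` but not `x`. The width identity leaves at most `m`
minimal primes below `I`. Some `g` from `M` to these identifies `a` with `b` and is onto even after
`a` or `b` is removed. Every member of `P` then either has constant `g` or meets all fibres of `g`,
so it can be sent to a minimal prime or to `I`; as `M` goes to `I`, the dual homomorphism
(`PHom.ofPrimeIdeals`) separates `x` from `y`. Necessity: `B̄ₘ` is finite, so some homomorphism into
`ε(P)` keeps its old top below the new one. It induces a surjection `g : M → Fin m`, which has
exactly one collision `{a, b}`, and each member of `P` is again constant or onto under `g`. This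
forces the three listed shapes. -/

open PAlgebra

/-! ### Pseudocomplements and homomorphisms -/

section basic

variable {α : Type u} [PAlgebra α]

theorem inf_pc_self (x : α) : x ⊓ pc x = ⊥ := by
  rw [inf_comm]; exact (inf_eq_bot_iff _ _).2 le_rfl

theorem pc_bot : pc (⊥ : α) = ⊤ :=
  top_le_iff.1 ((inf_eq_bot_iff _ _).1 (inf_bot_eq _))

theorem pc_top : pc (⊤ : α) = ⊥ :=
  le_bot_iff.1 (((inf_eq_bot_iff (pc (⊤ : α)) ⊤).2 le_rfl ▸ inf_top_eq _).ge)

theorem pc_sup_pc_self (x : α) : pc (x ⊔ pc x) = ⊥ := by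
  have h : pc (x ⊔ pc x) ⊓ (x ⊔ pc x) = ⊥ := (inf_eq_bot_iff _ _).2 le_rfl
  rw [inf_sup_left, sup_eq_bot_iff] at h
  have h2 : pc (x ⊔ pc x) ≤ pc x := (inf_eq_bot_iff _ _).1 h.1
  rw [← h.2, inf_eq_left.2 h2]

end basic

namespace PHom

variable {α : Type u} {β : Type v} [PAlgebra α] [PAlgebra β]

theorem map_eval (h : PHom α β) (ρ : ℕ → α) (t : PTerm) :
    h.toFun (t.eval ρ) = t.eval (fun n => h.toFun (ρ n)) := by
  induction t with
  | var n => rfl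
  | inf s t hs ht => simp only [PTerm.eval, h.map_inf, hs, ht]
  | sup s t hs ht => simp only [PTerm.eval, h.map_sup, hs, ht]
  | pc t ht => simp only [PTerm.eval, h.map_pc, ht]
  | bot => exact h.map_bot
  | top => exact h.map_top

/-- A homomorphism of p-algebras as a homomorphism of bounded lattices. -/
def toBoundedLatticeHom (h : PHom α β) : BoundedLatticeHom α β where
  toFun := h.toFun
  map_sup' := h.map_sup
  map_inf' := h.map_inf
  map_top' := h.map_top
  map_bot' := h.map_bot

end PHom

/-! ### Quasivarieties and separation of points -/

/-- If homomorphisms into `A` separate the points of `B`, then `B` lies in `Q(A)`. -/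
theorem mem_quasivarietyGen_of_separating {A : PAlg.{u}} {B : PAlg.{w}}
    (hs : ∀ x y : B.carrier, (∀ h : PHom B.carrier A.carrier, h.toFun x = h.toFun y) → x = y) :
    B ∈ (quasivarietyGen A : Set PAlg.{w}) := by
  intro q hq ρ hρ
  refine hs _ _ fun h => ?_
  rw [h.map_eval, h.map_eval]
  refine hq _ fun e he => ?_
  rw [← h.map_eval, ← h.map_eval, hρ e he]

/-- If a finite algebra `B` lies in `Q(A)`, then homomorphisms into `A` separate its points. -/
theorem separating_of_mem_quasivarietyGen {A : PAlg.{u}} {B : PAlg.{w}} [Finite B.carrier]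
    (hB : B ∈ (quasivarietyGen A : Set PAlg.{w})) {x y : B.carrier} (hxy : x ≠ y) :
    ∃ h : PHom B.carrier A.carrier, h.toFun x ≠ h.toFun y := by
  classical
  by_contra! hcon
  cases nonempty_fintype B.carrier
  obtain ⟨e, he⟩ : ∃ e : B.carrier → ℕ, Function.Injective e :=
    ⟨fun b => Fintype.equivFin _ b, fun a b hab => by
      simpa [Fin.val_inj] using hab⟩
  let v : B.carrier → PTerm := fun b => .var (e b)
  let L : List B.carrier := Finset.univ.toList
  have hL : ∀ b, b ∈ L := fun b => by simp [L]
  -- The positive diagram of `B`: an assignment in `A` satisfies it exactly when it restricts to a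
  -- homomorphism from `B`. The identity assignment in `B` satisfies it too, yet violates the
  -- conclusion.
  let prem : List (PTerm × PTerm) :=
    [(.bot, v ⊥), (.top, v ⊤)] ++ L.map (fun a => (.pc (v a), v (pc a))) ++
      (L ×ˢ L).map (fun p => (.inf (v p.1) (v p.2), v (p.1 ⊓ p.2))) ++
      (L ×ˢ L).map (fun p => (.sup (v p.1) (v p.2), v (p.1 ⊔ p.2)))
  let q : QuasiIdentity := ⟨prem, (v x, v y)⟩
  have hq : A.Models q := by
    intro ρ hρ
    have hmem : ∀ p ∈ prem, p.1.eval ρ = p.2.eval ρ := hρ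
    refine hcon ⟨fun b => ρ (e b), fun a b => ?_, fun a b => ?_, fun a => ?_, ?_, ?_⟩
    · exact (hmem (.inf (v a) (v b), v (a ⊓ b)) (by
        simp only [prem, List.mem_append, List.mem_map]
        exact Or.inl (Or.inr ⟨(a, b), List.mem_product.2 ⟨hL a, hL b⟩, rfl⟩))).symm
    · exact (hmem (.sup (v a) (v b), v (a ⊔ b)) (by
        simp only [prem, List.mem_append, List.mem_map]
        exact Or.inr ⟨(a, b), List.mem_product.2 ⟨hL a, hL b⟩, rfl⟩)).symm
    · exact (hmem (.pc (v a), v (pc a)) (by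
        simp only [prem, List.mem_append, List.mem_map]
        exact Or.inl (Or.inl (Or.inr ⟨a, hL a, rfl⟩)))).symm
    · exact (hmem (.bot, v ⊥) (by simp [prem])).symm
    · exact (hmem (.top, v ⊤) (by simp [prem])).symm
  have hinv : ∀ b, Function.invFun e (e b) = b := Function.leftInverse_invFun he
  refine hxy ?_
  have := hB q hq (Function.invFun e) ?_
  · simpa [q, v, PTerm.eval, hinv] using this
  · intro p hp
    simp only [q, prem, List.mem_append, List.mem_map, List.mem_cons, List.not_mem_nil,
      or_false] at hp
    rcases hp with (((rfl | rfl) | ⟨a, -, rfl⟩) | ⟨a, -, rfl⟩) | ⟨a, -, rfl⟩ <;>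
      simp [v, PTerm.eval, hinv]

instance ULift.instPAlgebra (α : Type u) [PAlgebra α] : PAlgebra (ULift.{v} α) where
  pc x := ⟨pc x.down⟩
  inf_eq_bot_iff x y := by
    rw [← ULift.down_injective.eq_iff]
    exact inf_eq_bot_iff x.down y.down

theorem ulift_mem_HSP (A : PAlg.{0}) :
    (⟨ULift.{w} A.carrier⟩ : PAlg.{w}) ∈ (HSP A : Set PAlg.{w}) :=
  ⟨PUnit, ⟨ULift.{w} A.carrier⟩,
    ⟨fun x _ => x.down, fun _ _ => rfl, fun _ _ => rfl, fun _ => rfl, rfl, rfl⟩,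
    ⟨id, fun _ _ => rfl, fun _ _ => rfl, fun _ => rfl, rfl, rfl⟩,
    fun _ _ h => ULift.down_injective (congrFun h PUnit.unit), Function.surjective_id⟩

/-- The coordinate projections of a direct power. -/
def PHom.proj {ι : Type v} {α : Type u} [PAlgebra α] (i : ι) : PHom (ι → α) α where
  toFun f := f i
  map_inf _ _ := rfl
  map_sup _ _ := rfl
  map_pc _ := rfl
  map_bot := rfl
  map_top := rfl

/-! ### The width identity -/

/-- The term `⋁ᵢ (tᵢ ∧ ⋀_{j ≠ i} tⱼ*)*`. A p-algebra in which it is identically `⊤` for `n + 1`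
arguments has at most `n` maximal prime filters above each prime filter. -/
def widthTerm {n : ℕ} {α : Type u} [PAlgebra α] (t : Fin n → α) : α :=
  Finset.univ.sup fun i => pc (t i ⊓ (Finset.univ.erase i).inf fun j => pc (t j))

theorem PHom.map_widthTerm {α : Type u} {β : Type v} [PAlgebra α] [PAlgebra β] (h : PHom α β)
    {n : ℕ} (t : Fin n → α) :
    h.toFun (widthTerm t) = widthTerm fun i => h.toFun (t i) := by
  refine (map_finset_sup h.toBoundedLatticeHom _ _).trans
    (Finset.sup_congr rfl fun i _ => ?_)
  refine (h.map_pc _).trans (congrArg pc ((h.map_inf _ _).trans (congrArg _ ?_)))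
  exact (map_finset_inf h.toBoundedLatticeHom _ _).trans
    (Finset.inf_congr rfl fun j _ => h.map_pc _)

theorem widthTerm_eq_top_of_mem_HSP {A : PAlg.{0}} {n : ℕ}
    (hA : ∀ t : Fin n → A.carrier, widthTerm t = ⊤)
    {B : PAlg.{w}} (hB : B ∈ (HSP A : Set PAlg.{w})) (t : Fin n → B.carrier) :
    widthTerm t = ⊤ := by
  obtain ⟨ι, C, e, h, he, hh⟩ := hB
  have hC : ∀ s : Fin n → C.carrier, widthTerm s = ⊤ := by
    refine fun s => he ?_
    rw [e.map_top]
    funext k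
    have := (PHom.proj k).map_widthTerm (fun i => e.toFun (s i))
    rw [← e.map_widthTerm, hA] at this
    exact this
  choose s hs using fun i => hh (t i)
  rw [← h.map_top, ← hC s, h.map_widthTerm]
  simp only [hs]

/-- The arguments `d i` of the outer pseudocomplements are pairwise disjoint. If all were nonzero,
they would lie above `m + 1` distinct atoms, but there are only `m`; so some `d i` is `⊥` and its
pseudocomplement is `⊤`. -/
theorem widthTerm_barB {m : ℕ} (hm : 0 < m) (t : Fin (m + 1) → (barB m).carrier) : widthTerm t = ⊤ := by
  set d : Fin (m + 1) → (barB m).carrier :=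
    fun i => t i ⊓ (Finset.univ.erase i).inf fun j => pc (t j)
  have hdisj : ∀ i j, i ≠ j → d i ⊓ d j = ⊥ := by
    intro i j hij
    refine le_bot_iff.1 (le_trans (le_inf (inf_le_left.trans inf_le_left) ?_)
      (inf_pc_self (t i)).le)
    exact inf_le_right.trans (inf_le_right.trans (Finset.inf_le (by simp [hij])))
  obtain ⟨i, hi⟩ : ∃ i, d i = ⊥ := by
    by_contra! hne
    let atom : Fin m → (barB m).carrier := fun p => (({p} : Set (Fin m)) : WithTop (Set (Fin m)))
    have hpt' : ∀ x : (barB m).carrier, x ≠ ⊥ → ∃ p : Fin m, atom p ≤ x := by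
      intro x hx
      induction x using WithTop.recTopCoe with
      | top =>
        exact ⟨⟨0, hm⟩, le_top⟩
      | coe s =>
        obtain ⟨p, hp⟩ : s.Nonempty := by
          by_contra hs
          exact hx (congrArg _ (Set.not_nonempty_iff_eq_empty.1 hs))
        exact ⟨p, WithTop.coe_le_coe.2 (Set.singleton_subset_iff.2 hp)⟩
    have hpt : ∀ i, ∃ p : Fin m, atom p ≤ d i := fun i => hpt' _ (hne i)
    choose p hp using hpt
    have hinj : Function.Injective p := by
      intro i j hij
      by_contra hne'
      have h1 : atom (p i) ≤ d i ⊓ d j := le_inf (hp i) (hij ▸ hp j)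
      rw [hdisj i j hne'] at h1
      have h2 : ({p i} : Set (Fin m)) ≤ ∅ := WithTop.coe_le_coe.1 h1
      exact h2 (Set.mem_singleton _)
    simpa using Fintype.card_le_of_injective p hinj
  refine top_le_iff.1 (le_trans ?_ (Finset.le_sup (Finset.mem_univ i)))
  change ⊤ ≤ pc (d i)
  rw [hi, pc_bot]

/-! ### Minimal prime ideals -/

namespace Order.Ideal

variable {α : Type u} [PAlgebra α]

/-- A prime ideal whose complement is a maximal filter. -/
structure IsMinimalPrime (J : Ideal α) : Prop where
  isPrime : J.IsPrime
  notMem_or : ∀ x, x ∉ J ∨ pc x ∉ J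

theorem IsPrime.mem_or_pc_mem {J : Ideal α} (hJ : J.IsPrime) (x : α) : x ∈ J ∨ pc x ∈ J :=
  hJ.mem_or_mem (by rw [inf_pc_self]; exact J.bot_mem)

theorem IsMinimalPrime.pc_mem_iff {J : Ideal α} (hJ : J.IsMinimalPrime) (x : α) :
    pc x ∈ J ↔ x ∉ J := by
  have h1 := hJ.isPrime.mem_or_pc_mem x
  have h2 := hJ.notMem_or x
  tauto

theorem IsMinimalPrime.eq_of_le {J K : Ideal α} (hJ : J.IsMinimalPrime)
    (hK : K.IsMinimalPrime) (h : J ≤ K) : J = K := by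
  refine le_antisymm h fun x hx => ?_
  by_contra hxJ
  exact (hK.pc_mem_iff x).1 (h ((hJ.pc_mem_iff x).2 hxJ)) hx

theorem exists_isPrime_of_not_le {x y : α} (h : ¬ x ≤ y) :
    ∃ J : Ideal α, J.IsPrime ∧ x ∉ J ∧ y ∈ J := by
  have hd : Disjoint (PFilter.principal x : Set α) (principal y : Set α) :=
    Set.disjoint_left.2 fun z hz hz' => h (le_trans hz hz')
  obtain ⟨J, hJ, hle, hdis⟩ := DistribLattice.prime_ideal_of_disjoint_filter_ideal hd
  exact ⟨J, hJ, Set.disjoint_left.1 hdis (PFilter.mem_principal.2 le_rfl),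
    hle (mem_principal.2 le_rfl)⟩

theorem IsPrime.exists_isMinimalPrime_le {I : Ideal α} (hI : I.IsPrime) {b : α}
    (hb : pc b ∈ I) : ∃ J : Ideal α, J.IsMinimalPrime ∧ J ≤ I ∧ b ∉ J := by
  -- The filter generated by the complement of `I`, by `b` and by all dense elements. A prime ideal
  -- avoiding it lies in `I`, omits `b`, and is minimal because each `x ⊔ pc x` is dense.
  let S : Set α := {z | ∃ a d, a ∉ I ∧ pc d = ⊥ ∧ a ⊓ b ⊓ d ≤ z}
  have hS : IsPFilter S := by
    refine IsPFilter.of_def ⟨⊤, ⊤, ⊤, hI.toIsProper.top_notMem, pc_top, le_top⟩ ?_ ?_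
    · rintro x ⟨a, d, ha, hd, hx⟩ y ⟨a', d', ha', hd', hy⟩
      refine ⟨x ⊓ y, ⟨a ⊓ a', d ⊓ d', ?_, ?_, ?_⟩, inf_le_left, inf_le_right⟩
      · exact fun h => (hI.mem_or_mem h).elim ha ha'
      · have h : pc (d ⊓ d') ⊓ (d ⊓ d') = ⊥ := (inf_eq_bot_iff _ _).2 le_rfl
        rw [← inf_assoc, inf_eq_bot_iff, hd', le_bot_iff, inf_eq_bot_iff, hd, le_bot_iff] at h
        exact h
      · refine le_inf (le_trans ?_ hx) (le_trans ?_ hy)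
        · exact inf_le_inf (inf_le_inf_right _ inf_le_left) inf_le_left
        · exact inf_le_inf (inf_le_inf_right _ inf_le_right) inf_le_right
    · rintro x y hxy ⟨a, d, ha, hd, hx⟩
      exact ⟨a, d, ha, hd, hx.trans hxy⟩
  have hdis : Disjoint (hS.toPFilter : Set α) ((⊥ : Ideal α) : Set α) := by
    refine Set.disjoint_left.2 ?_
    rintro z ⟨a, d, ha, hd, hz⟩ hz'
    have hz0 : z = ⊥ := le_bot_iff.1 hz'
    replace hz : a ⊓ b ⊓ d ≤ z := hz
    rw [hz0, le_bot_iff, inf_eq_bot_iff, hd, le_bot_iff, inf_eq_bot_iff] at hz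
    exact ha (I.lower hz hb)
  obtain ⟨J, hJ, -, hJS⟩ := DistribLattice.prime_ideal_of_disjoint_filter_ideal hdis
  have hnot : ∀ z ∈ S, z ∉ J := fun z hz => Set.disjoint_left.1 hJS hz
  refine ⟨J, ⟨hJ, fun x => ?_⟩, fun x hx => ?_, hnot b ?_⟩
  · by_contra! hcon
    exact hnot (x ⊔ pc x) ⟨⊤, _, hI.toIsProper.top_notMem, pc_sup_pc_self x, inf_le_right⟩
      (sup_mem hcon.1 hcon.2)
  · by_contra hxI
    exact hnot x ⟨x, ⊤, hxI, pc_top, inf_le_left.trans inf_le_left⟩ hx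
  · exact ⟨⊤, ⊤, hI.toIsProper.top_notMem, pc_top, inf_le_left.trans inf_le_right⟩

/-- If the width identity for `n` arguments holds, there are fewer than `n` minimal prime ideals
below any prime ideal. -/
theorem IsPrime.not_injective_isMinimalPrime {n : ℕ} (hw : ∀ t : Fin n → α, widthTerm t = ⊤)
    {I : Ideal α} (hI : I.IsPrime) (u : Fin n → Ideal α) (hu : ∀ i, (u i).IsMinimalPrime)
    (hle : ∀ i, u i ≤ I) : ¬ Function.Injective u := by
  intro hinj
  have hsep : ∀ i j, ∃ b, i ≠ j → b ∉ u i ∧ b ∈ u j := by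
    intro i j
    by_cases hij : i = j
    · exact ⟨⊥, fun h => absurd hij h⟩
    · have : ¬ u j ≤ u i := fun h => hij (hinj ((hu j).eq_of_le (hu i) h)).symm
      obtain ⟨b, hb, hb'⟩ := SetLike.not_le_iff_exists.1 this
      exact ⟨b, fun _ => ⟨hb', hb⟩⟩
  choose b hb using hsep
  have hinf : ∀ (J : Ideal α), J.IsPrime → ∀ (s : Finset (Fin n)) (f : Fin n → α),
      (∀ j ∈ s, f j ∉ J) → s.inf f ∉ J := by
    intro J hJ s f hf
    refine Finset.inf_induction (p := fun x => x ∉ J) hJ.toIsProper.top_notMem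
      (fun x hx y hy h => (hJ.mem_or_mem h).elim hx hy) hf
  -- Chosen so that `t i ∈ u j` exactly when `i ≠ j`; then every joinand of `widthTerm t` lies in
  -- some `u i ≤ I`.
  let t : Fin n → α := fun i => (Finset.univ.erase i).inf (b i)
  have ht : ∀ i, t i ∉ u i := fun i => hinf _ (hu i).isPrime _ _ fun j hj =>
    (hb i j (Finset.ne_of_mem_erase hj).symm).1
  have ht' : ∀ i j, i ≠ j → t i ∈ u j := fun i j hij =>
    (u j).lower (Finset.inf_le (by simp [hij.symm])) (hb i j hij).2
  have hmem : widthTerm t ∈ I := by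
    refine Finset.sup_induction (p := fun x => x ∈ I) I.bot_mem
      (fun x hx y hy => sup_mem hx hy) fun i _ => hle i ?_
    rw [(hu i).pc_mem_iff]
    refine fun h => ((hu i).isPrime.mem_or_mem h).elim (ht i) ?_
    refine hinf _ (hu i).isPrime _ _ fun j hj => ?_
    rw [(hu i).pc_mem_iff, not_not]
    exact ht' j i (Finset.ne_of_mem_erase hj)
  rw [hw] at hmem
  exact hI.toIsProper.top_notMem hmem

end Order.Ideal

/-! ### Dual homomorphisms and finite counting -/

/-- The homomorphism into upsets dual to a map from a poset into the prime ideals. -/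
def PHom.ofPrimeIdeals {α : Type u} [PAlgebra α] {P : Type v} [PartialOrder P]
    (J : P → Order.Ideal α) (hJ : ∀ X, (J X).IsPrime) (hanti : Antitone J)
    (hpc : ∀ X x, pc x ∈ J X → ∃ Y, X ≤ Y ∧ x ∉ J Y) : PHom α (Upset P) where
  toFun x := ⟨{X | x ∉ J X}, fun _ _ h hx hx' => hx (hanti h hx')⟩
  map_inf x y := by
    refine le_antisymm
      (fun X hX => ⟨fun h => hX ((J X).lower inf_le_left h),
        fun h => hX ((J X).lower inf_le_right h)⟩)
      (fun X hX h => ((hJ X).mem_or_mem h).elim hX.1 hX.2)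
  map_sup x y := by
    refine le_antisymm (fun X hX => ?_) (fun X hX h => ?_)
    · by_contra hcon
      refine hX (Order.Ideal.sup_mem ?_ ?_)
      · by_contra h
        exact hcon (Or.inl h)
      · by_contra h
        exact hcon (Or.inr h)
    · have := Order.Ideal.sup_mem_iff.1 h
      exact hX.elim (fun h' => h' this.1) (fun h' => h' this.2)
  map_pc x := by
    refine le_antisymm (fun X hX Y hXY hY => ?_) (fun X hX h => ?_)
    · exact ((hJ Y).mem_or_pc_mem x).elim hY fun h => hX (hanti hXY h)
    · obtain ⟨Y, hXY, hY⟩ := hpc X x h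
      exact hX Y hXY hY
  map_bot := le_bot_iff.1 fun X hX => hX (J X).bot_mem
  map_top := top_le_iff.1 fun X _ => (hJ X).toIsProper.top_notMem

/-- A nonempty type with no `m + 1` distinct elements is the image of a map from an
`m + 1`-element type that identifies two prescribed points. -/
theorem exists_surjective_identifying {M : Type u} {m : ℕ} (hM : Nat.card M = m + 1)
    {S : Type v} [Nonempty S] (hS : ∀ f : Fin (m + 1) → S, ¬ Function.Injective f)
    {a b : M} (hab : a ≠ b) : ∃ g : M → S, g a = g b ∧ ∀ s, (∃ x, x ≠ a ∧ g x = s) := by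
  classical
  have hfM : Finite M := Nat.finite_of_card_ne_zero (by omega)
  have hfS : Finite S := by
    by_contra h
    rw [not_finite_iff_infinite] at h
    exact hS (fun i => Infinite.natEmbedding S i)
      ((Infinite.natEmbedding S).injective.comp Fin.val_injective)
  cases nonempty_fintype M
  cases nonempty_fintype S
  have hcS : Fintype.card S ≤ m := by
    by_contra! h
    have : Fintype.card (Fin (m + 1)) ≤ Fintype.card S := by simpa using h
    obtain ⟨f⟩ := Function.Embedding.nonempty_of_card_le this
    exact hS f f.injective
  have hcM : Fintype.card {x : M // x ≠ a} = m := by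
    rw [Nat.card_eq_fintype_card] at hM
    simp [Fintype.card_subtype_compl, hM]
  obtain ⟨f⟩ := Function.Embedding.nonempty_of_card_le (hcM ▸ hcS)
  -- A retraction onto `S`, already surjective without `a`; `a` can therefore copy the value at `b`.
  let r : {x : M // x ≠ a} → S := Function.invFun f
  have hr : ∀ s, r (f s) = s := Function.leftInverse_invFun f.injective
  refine ⟨fun x => if h : x = a then r ⟨b, hab.symm⟩ else r ⟨x, h⟩, ?_, fun s => ?_⟩
  · simp [hab.symm]
  · exact ⟨f s, (f s).2, (dif_neg (f s).2).trans (hr s)⟩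

/-- Once one of two colliding points `a` is removed, a surjection from `m` points to `m` points
remains, so it is injective. -/
theorem exists_unique_collision {M : Type u} {m : ℕ} (hM : Nat.card M = m + 1)
    (g : M → Fin m) (hg : Function.Surjective g) :
    ∃ a b, a ≠ b ∧ ∀ z z', z ≠ z' → g z = g z' → (z = a ∧ z' = b) ∨ (z = b ∧ z' = a) := by
  classical
  have hfM : Finite M := Nat.finite_of_card_ne_zero (by omega)
  cases nonempty_fintype M
  rw [Nat.card_eq_fintype_card] at hM
  obtain ⟨a, b, hab, hgab⟩ := Fintype.exists_ne_map_eq_of_card_lt g (by simp [hM])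
  have hbij : Function.Bijective fun x : {x : M // x ≠ a} => g x := by
    rw [Fintype.bijective_iff_surjective_and_card]
    refine ⟨fun i => ?_, by simp [Fintype.card_subtype_compl, hM]⟩
    obtain ⟨z, rfl⟩ := hg i
    by_cases hz : z = a
    · exact ⟨⟨b, hab.symm⟩, by simp [hz, hgab]⟩
    · exact ⟨⟨z, hz⟩, rfl⟩
  have hinj : ∀ z z', z ≠ a → z' ≠ a → g z = g z' → z = z' := fun z z' hz hz' h =>
    congrArg Subtype.val (@hbij.1 ⟨z, hz⟩ ⟨z', hz'⟩ h)
  refine ⟨a, b, hab, fun z z' hne h => ?_⟩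
  by_cases hz : z = a
  · subst hz
    exact Or.inl ⟨rfl, hinj _ _ hne.symm hab.symm (h.symm.trans hgab)⟩
  · by_cases hz' : z' = a
    · subst hz'
      exact Or.inr ⟨hinj _ _ hz hab.symm (h.trans hgab), rfl⟩
    · exact absurd (hinj _ _ hz hz' h) hne

/-! ### Sufficiency -/

theorem Pa_subset_quasivarietyGen {m : ℕ} (hm : 2 ≤ m) {M : Type u} (hM : Nat.card M = m + 1)
    {F : Set (Set M)} (hF : ∀ X ∈ F, X.Nonempty) {a b : M} (hab : a ≠ b)
    (hsub : F \ baseSets M ⊆ {({a, b} : Set M), Set.univ \ {a}, Set.univ \ {b}}) :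
    (Pa m : Set PAlg.{w}) ⊆ quasivarietyGen (dualAlg (ReducedPoset M F)) := by
  classical
  intro B hB
  refine mem_quasivarietyGen_of_separating fun x y hxy => ?_
  suffices key : ∀ x y : B.carrier,
      (∀ h : PHom B.carrier (Upset (ReducedPoset M F)), h.toFun x = h.toFun y) → x ≤ y from
    le_antisymm (key x y hxy) (key y x fun h => (hxy h).symm)
  clear hxy x y
  intro x y hxy
  by_contra hle
  obtain ⟨I, hI, hx, hy⟩ := Order.Ideal.exists_isPrime_of_not_le hle
  let S := {J : Order.Ideal B.carrier // J.IsMinimalPrime ∧ J ≤ I}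
  have hw : ∀ t : Fin (m + 1) → B.carrier, widthTerm t = ⊤ :=
    widthTerm_eq_top_of_mem_HSP (widthTerm_barB (by omega)) hB
  have hS : ∀ f : Fin (m + 1) → S, ¬ Function.Injective f := fun f hf =>
    hI.not_injective_isMinimalPrime hw (fun i => (f i).1) (fun i => (f i).2.1)
      (fun i => (f i).2.2) (Subtype.val_injective.comp hf)
  have : Nonempty S := by
    obtain ⟨J, hJ, hJI, -⟩ := hI.exists_isMinimalPrime_le (b := ⊤) (by
      rw [pc_top]; exact I.bot_mem)
    exact ⟨⟨J, hJ, hJI⟩⟩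
  obtain ⟨g, hg, hsurj⟩ := exists_surjective_identifying hM hS hab
  have hnt : ∀ z : M, ({z} : Set M) ≠ Set.univ := fun z hz => by
    have := Set.ncard_univ M
    rw [← hz, Set.ncard_singleton, hM] at this
    omega
  have hne : ∀ X : ReducedPoset M F, X.1.Nonempty := by
    rintro ⟨X, (rfl | ⟨z, rfl⟩) | hX⟩
    · exact ⟨a, trivial⟩
    · exact Set.singleton_nonempty z
    · exact hF X hX
  -- sets on which `g` is constant, except `M`, go to that constant; all others go to `I`
  let J : ReducedPoset M F → Order.Ideal B.carrier := fun X =>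
    if X.1 ≠ Set.univ ∧ ∀ z ∈ X.1, ∀ z' ∈ X.1, g z = g z' then (g (hne X).some).1 else I
  have hJmin : ∀ X, X.1 ≠ Set.univ → ∀ s, (∀ z ∈ X.1, g z = s) → J X = s.1 := by
    intro X hX s hs
    have : X.1 ≠ Set.univ ∧ ∀ z ∈ X.1, ∀ z' ∈ X.1, g z = g z' :=
      ⟨hX, fun z hz z' hz' => (hs z hz).trans (hs z' hz').symm⟩
    simp only [J, if_pos this, hs _ (hne X).some_mem]
  have hJcases : ∀ X, (X.1 ≠ Set.univ ∧ ∃ s, (∀ z ∈ X.1, g z = s) ∧ J X = s.1) ∨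
      (J X = I ∧ ∀ s, ∃ z ∈ X.1, g z = s) := by
    intro X
    by_cases hX : X.1 ≠ Set.univ ∧ ∀ z ∈ X.1, ∀ z' ∈ X.1, g z = g z'
    · exact Or.inl ⟨hX.1, _, fun z hz => hX.2 z hz _ (hne X).some_mem,
        hJmin X hX.1 _ fun z hz => hX.2 z hz _ (hne X).some_mem⟩
    · refine Or.inr ⟨if_neg hX, fun s => ?_⟩
      obtain ⟨z, hza, hz⟩ := hsurj s
      by_cases hXu : X.1 = Set.univ
      · exact ⟨z, hXu ▸ trivial, hz⟩
      have hnc : ¬ ∀ z ∈ X.1, ∀ z' ∈ X.1, g z = g z' := fun h => hX ⟨hXu, h⟩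
      have hbase : X.1 ∉ baseSets M := by
        rintro (h | ⟨c, hc⟩)
        · exact hXu h
        · refine hnc fun z hz z' hz' => ?_
          rw [hc] at hz hz'
          rw [hz, hz']
      rcases hsub ⟨X.2.resolve_left hbase, hbase⟩ with h | h | h
      · refine absurd ?_ hnc
        rw [h]
        rintro _ (rfl | rfl) _ (rfl | rfl) <;> simp [hg]
      · exact ⟨z, by rw [h]; exact ⟨trivial, hza⟩, hz⟩
      · rw [Set.mem_singleton_iff] at h
        -- The preimage is only known to avoid `a`; if it is the missing point `b`, then `a`
        -- replaces it because `g a = g b`.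
        by_cases hzb : z = b
        · exact ⟨a, by rw [h]; exact ⟨trivial, hab⟩, by rw [hg, ← hzb, hz]⟩
        · exact ⟨z, by rw [h]; exact ⟨trivial, hzb⟩, hz⟩
  have hprime : ∀ X, (J X).IsPrime := by
    intro X
    obtain ⟨-, s, -, h⟩ | ⟨h, -⟩ := hJcases X
    · rw [h]; exact s.2.1.isPrime
    · rw [h]; exact hI
  have hanti : Antitone J := by
    intro X Y hXY
    obtain ⟨hX, s, hs, h⟩ | ⟨h, -⟩ := hJcases X
    · rw [h, hJmin Y ?_ s fun z hz => hs z (hXY hz)]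
      intro hY
      exact hX (Set.univ_subset_iff.1 (hY ▸ hXY))
    · rw [h]
      obtain ⟨-, s, -, h'⟩ | ⟨h', -⟩ := hJcases Y
      · rw [h']; exact s.2.2
      · rw [h']
  have hpc : ∀ X c, pc c ∈ J X → ∃ Y, X ≤ Y ∧ c ∉ J Y := by
    intro X c hc
    obtain ⟨hX, s, hs, h⟩ | ⟨h, hsu⟩ := hJcases X
    · refine ⟨X, le_rfl, ?_⟩
      rw [h] at hc ⊢
      exact (s.2.1.pc_mem_iff c).1 hc
    · rw [h] at hc
      obtain ⟨K, hK, hKI, hcK⟩ := hI.exists_isMinimalPrime_le hc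
      obtain ⟨z, hz, hgz⟩ := hsu ⟨K, hK, hKI⟩
      -- The singletons inside `X` realise all minimal primes below `I`, in particular the `K` that
      -- omits `c`.
      let Z : ReducedPoset M F := ⟨{z}, Or.inl (Or.inr ⟨z, rfl⟩)⟩
      refine ⟨Z, Set.singleton_subset_iff.2 hz, ?_⟩
      rw [hJmin Z (hnt z) ⟨K, hK, hKI⟩ (fun y hy => by rw [hy, hgz])]
      exact hcK
  let T : ReducedPoset M F := ⟨Set.univ, Or.inl (Or.inl rfl)⟩
  -- This holds even when `g` is constant on `M`, which is why `J` treats `M` separately.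
  have hT : J T = I := if_neg fun h => h.1 rfl
  have h := congrArg Upset.carrier (hxy (PHom.ofPrimeIdeals J hprime hanti hpc))
  have hmem : T ∈ {X | x ∉ J X} := by
    change x ∉ J T
    rwa [hT]
  have hmem' : T ∈ {X | y ∉ J X} := by
    change {X | x ∉ J X} = {X | y ∉ J X} at h
    rwa [← h]
  exact hmem' (hT ▸ hy)

/-! ### Necessity -/

theorem barB_pc_coe {m : ℕ} {s : Set (Fin m)} (hs : s ≠ ∅) :
    pc ((s : WithTop (Set (Fin m)))) = ((sᶜ : Set (Fin m)) : WithTop (Set (Fin m))) :=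
  if_neg hs

theorem exists_pair_of_quasivarietyGen {m : ℕ} (hm : 2 ≤ m) {M : Type u}
    (hM : Nat.card M = m + 1) {F : Set (Set M)} (hF : ∀ X ∈ F, X.Nonempty)
    (hsub : (Pa m : Set PAlg.{w}) ⊆ quasivarietyGen (dualAlg (ReducedPoset M F))) :
    ∃ a b : M, a ≠ b ∧
      F \ baseSets M ⊆ {({a, b} : Set M), Set.univ \ {a}, Set.univ \ {b}} := by
  classical
  have hfM : Finite M := Nat.finite_of_card_ne_zero (by omega)
  have hfB : Finite (ULift.{w} (barB m).carrier) := by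
    have : Finite (Option (Set (Fin m))) := inferInstance
    have : Finite (barB m).carrier := this
    infer_instance
  let c : Set (Fin m) → ULift.{w} (barB m).carrier := fun s => ⟨(s : WithTop (Set (Fin m)))⟩
  have hne : c Set.univ ≠ ⊤ := fun h => WithTop.coe_ne_top (congrArg ULift.down h)
  obtain ⟨h, hh⟩ := separating_of_mem_quasivarietyGen (hsub (ulift_mem_HSP (barB m))) hne
  rw [h.map_top] at hh
  let H : Set (Fin m) → Set (ReducedPoset M F) := fun s => (h.toFun (c s)).carrier
  -- For empty `s` the pseudocomplement in `B̄ₘ` is the new top, not `c Set.univ`.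
  have hpc : ∀ s, s.Nonempty → ∀ X, X ∈ H sᶜ ↔ ∀ Y, X ≤ Y → Y ∉ H s := by
    intro s hs X
    have h1 : pc (c s) = c sᶜ := congrArg ULift.up (barB_pc_coe hs.ne_empty)
    have h2 := congrArg Upset.carrier (h.map_pc (c s))
    rw [h1] at h2
    exact iff_of_eq (congrArg (X ∈ ·) h2)
  have hbot : H ∅ = ∅ := congrArg Upset.carrier h.map_bot
  have hsup : ∀ s t, H (s ∪ t) = H s ∪ H t := fun s t =>
    congrArg Upset.carrier (h.map_sup (c s) (c t))
  have hinf : ∀ s t, H (s ∩ t) = H s ∩ H t := fun s t =>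
    congrArg Upset.carrier (h.map_inf (c s) (c t))
  have hmono : ∀ {s t}, s ⊆ t → H s ⊆ H t := fun {s t} hst => by
    rw [← Set.union_eq_self_of_subset_left hst, hsup]
    exact Set.subset_union_left
  have hup : ∀ s, IsUpperSet (H s) := fun s => (h.toFun (c s)).upper
  have hXne : ∀ X : ReducedPoset M F, X.1.Nonempty := by
    have : Nonempty M := (Nat.card_pos_iff.1 (by omega)).1
    rintro ⟨X, (rfl | ⟨z, rfl⟩) | hX⟩
    · exact Set.univ_nonempty
    · exact Set.singleton_nonempty z
    · exact hF X hX
  have hpos : Nonempty (Fin m) := ⟨⟨0, by omega⟩⟩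
  have huniv : H Set.univ ≠ Set.univ := by
    intro hcon
    refine hh (le_antisymm le_top fun X _ => ?_)
    change X ∈ H Set.univ
    rw [hcon]; trivial
  let pt : M → ReducedPoset M F := fun z => ⟨{z}, Or.inl (Or.inr ⟨z, rfl⟩)⟩
  have hpt : ∀ z X, pt z ≤ X → X = pt z := fun z X hX =>
    Subtype.ext ((Set.Nonempty.subset_singleton_iff (hXne X)).1 hX)
  have hptle : ∀ (X : ReducedPoset M F) z, z ∈ X.1 → X ≤ pt z := fun X z hz =>
    Set.singleton_subset_iff.2 hz
  have hHuniv : ∀ X ∈ H Set.univ, ∃ i, X ∈ H {i} := by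
    intro X hX
    by_contra! hcon
    have h2 : ∀ s : Finset (Fin m), X ∉ H (s : Set (Fin m)) := by
      intro s
      induction s using Finset.induction_on with
      | empty => simp [hbot]
      | insert i s _ ih =>
        rw [Finset.coe_insert, Set.insert_eq, hsup]
        exact fun h => h.elim (hcon i) ih
    exact h2 Finset.univ (by simpa using hX)
  -- Singletons are maximal in `P`, so one outside `H Set.univ` would lie in its pseudocomplement `H
  -- ∅ = ∅`.
  have hptmem : ∀ z, ∃ i, pt z ∈ H {i} := by
    refine fun z => hHuniv _ ?_
    by_contra h1
    have h2 : pt z ∈ H Set.univᶜ := by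
      rw [hpc _ Set.univ_nonempty]
      intro Y hY
      rwa [hpt z Y hY]
    rw [Set.compl_univ, hbot] at h2
    exact h2
  choose g hg using hptmem
  have hguniq : ∀ z i, pt z ∈ H {i} → g z = i := by
    intro z i hi
    by_contra hne
    have h1 : pt z ∈ H ({g z} ∩ {i}) := by rw [hinf]; exact ⟨hg z, hi⟩
    have h2 : ({g z} ∩ {i} : Set (Fin m)) = ∅ := by simpa using Ne.symm hne
    rw [h2, hbot] at h1
    exact h1
  -- If `X` had no point over `i`, nothing above `X` would lie in `H {i}`, so `X` would lie in `H
  -- {i}ᶜ`, hence in `H Set.univ`.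
  have hmeet : ∀ X, X ∉ H Set.univ → ∀ i, ∃ z ∈ X.1, g z = i := by
    intro X hX i
    by_contra! hcon
    refine hX (hmono (Set.subset_univ _) ((hpc {i} (Set.singleton_nonempty i) X).2 ?_))
    intro Y hXY hY
    obtain ⟨z, hz⟩ := hXne Y
    exact hcon z (hXY hz) (hguniq z i (hup _ (hptle Y z hz) hY))
  have hconst : ∀ X ∈ H Set.univ, ∀ z ∈ X.1, ∀ z' ∈ X.1, g z = g z' := by
    intro X hX z hz z' hz'
    obtain ⟨i, hi⟩ := hHuniv X hX
    rw [hguniq z i (hup _ (hptle X z hz) hi), hguniq z' i (hup _ (hptle X z' hz') hi)]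
  have hsurj : Function.Surjective g := by
    obtain ⟨X, hX⟩ := (Set.ne_univ_iff_exists_notMem _).1 huniv
    intro i
    obtain ⟨z, -, hz⟩ := hmeet X hX i
    exact ⟨z, hz⟩
  obtain ⟨a, b, hab, huq⟩ := exists_unique_collision hM g hsurj
  refine ⟨a, b, hab, ?_⟩
  rintro X ⟨hXF, hXb⟩
  let X' : ReducedPoset M F := ⟨X, Or.inr hXF⟩
  -- If `g` is constant on the non-singleton `X`, then `X` is the collision pair. Otherwise `g` maps
  -- `X` onto `Fin m`, so a missing point must be `a` or `b`, with its partner in `X`.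
  by_cases hX : X' ∈ H Set.univ
  · left
    have hc : ∀ z ∈ X, ∀ z' ∈ X, g z = g z' := hconst X' hX
    obtain ⟨z, hz⟩ := hF X hXF
    obtain ⟨z', hz', hzz⟩ : ∃ z' ∈ X, z' ≠ z := by
      by_contra! hcon
      exact hXb (Or.inr ⟨z, Set.Subset.antisymm hcon (Set.singleton_subset_iff.2 hz)⟩)
    have hab' : a ∈ X ∧ b ∈ X := by
      rcases huq z' z hzz (hc _ hz' _ hz) with ⟨rfl, rfl⟩ | ⟨rfl, rfl⟩
      · exact ⟨hz', hz⟩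
      · exact ⟨hz, hz'⟩
    refine Set.Subset.antisymm (fun y hy => ?_) ?_
    · by_cases hya : y = a
      · exact Or.inl hya
      · rcases huq y a hya (hc _ hy _ hab'.1) with ⟨h1, -⟩ | ⟨h1, -⟩
        · exact Or.inl h1
        · exact Or.inr h1
    · rintro _ (rfl | rfl)
      exacts [hab'.1, hab'.2]
  · right
    have hm' : ∀ i, ∃ z ∈ X, g z = i := hmeet X' hX
    have hmiss : ∀ y, y ∉ X → y = a ∧ b ∈ X ∨ y = b ∧ a ∈ X := by
      intro y hy
      obtain ⟨z, hz, hgz⟩ := hm' (g y)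
      rcases huq y z (fun h => hy (h ▸ hz)) hgz.symm with ⟨rfl, rfl⟩ | ⟨rfl, rfl⟩
      · exact Or.inl ⟨rfl, hz⟩
      · exact Or.inr ⟨rfl, hz⟩
    obtain ⟨y, hy⟩ : ∃ y, y ∉ X := by
      by_contra! hcon
      exact hXb (Or.inl (Set.eq_univ_of_forall hcon))
    rcases hmiss y hy with ⟨rfl, hb⟩ | ⟨rfl, ha⟩
    · left
      ext z
      refine ⟨fun hz => ⟨trivial, fun h => hy (h ▸ hz)⟩, fun hz => ?_⟩
      by_contra hzX
      rcases hmiss z hzX with ⟨rfl, -⟩ | ⟨rfl, -⟩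
      · exact hz.2 rfl
      · exact hzX hb
    · right
      ext z
      refine ⟨fun hz => ⟨trivial, fun h => hy (h ▸ hz)⟩, fun hz => ?_⟩
      by_contra hzX
      rcases hmiss z hzX with ⟨rfl, -⟩ | ⟨rfl, -⟩
      · exact hzX ha
      · exact hz.2 rfl

theorem theorem3p3 (m : ℕ) (hm : 2 ≤ m) (M : Type u) (hM : Nat.card M = m + 1)
    (F : Set (Set M)) (hF : ∀ X ∈ F, X.Nonempty) :
    (Pa m : Set PAlg.{w}) ⊆ quasivarietyGen (dualAlg (ReducedPoset M F)) ↔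
      ∃ a b : M, a ≠ b ∧
        F \ baseSets M ⊆ {({a, b} : Set M), Set.univ \ {a}, Set.univ \ {b}} :=
  ⟨exists_pair_of_quasivarietyGen hm hM hF,
    fun ⟨_, _, hab, h⟩ => Pa_subset_quasivarietyGen hm hM hF hab h⟩
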